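/- Let $p$ be an odd prime, let $a$ be an integer such that $X^p-a$ is irreducible over $\mathbb{Z}$ (so $a\neq 0,\pm1$), and let $K=\mathbb{Q}(\alpha)$ with $\alpha^p=a$; write $\mathcal{O}_K$ for the ring of integers of $K$. Suppose that $p$ is a Wieferich prime to base $a$, i.e. $p^2$ divides $a^{p-1}-1$, and put $\beta'=(\alpha-a)^{p-1}/p$. For a prime $q$, a subring $R$ of $\mathcal{O}_K$ is called $q$-maximal if the index $[\mathcal{O}_K:R]$ is finite and not divisible by $q$. Then $\beta'\in\mathcal{O}_K$, the ring $\mathbb{Z}[\beta']$ is an order of $K$ (it has finite index in $\mathcal{O}_K$), and: (i) If $p\geq 5$, then $\mathbb{Z}[\beta']$ is $p$-maximal. (ii) If $p=3$, then the ring $\mathbb{Z}[\beta']\cdot\mathbb{Z}[\alpha]$, consisting of all finite sums of products $xy$ with $x\in\mathbb{Z}[\beta']$ and $y\in\mathbb{Z}[\alpha]$, is $3$-maximal. (iii) If $p=3$, then $\mathbb{Z}[\beta']$ itself need not be $3$-maximal: for $a=19$ the prime $3$ is a Wieferich prime to base $a$, $X^3-19$ is irreducible over $\mathbb{Z}$,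 and $\mathbb{Z}[\beta']$ is not $3$-maximal. -/

import Mathlib

namespace RadicalExt

/-- `q` is a Wieferich prime to base `r`: `r` is a nonzero integer different from `1` and `-1`,
`q` is a prime number and `q ^ 2` divides `r ^ (q - 1) - 1`. -/
def IsWieferichPrime (q : ℕ) (r : ℤ) : Prop :=
  q.Prime ∧ r ≠ 0 ∧ r ≠ 1 ∧ r ≠ -1 ∧ (q : ℤ) ^ 2 ∣ r ^ (q - 1) - 1

/-- `K = ℚ(α)` where `α` is an `n`-th root of the integer `a`, and `X ^ n - a` is irreducible
over `ℤ`. -/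
structure IsRadicalExtension (n : ℕ) (a : ℤ) (K : Type*) [Field K] [NumberField K] (α : K) :
    Prop where
  two_le : 2 ≤ n
  irreducible : Irreducible (Polynomial.X ^ n - Polynomial.C a : Polynomial ℤ)
  pow_eq : α ^ n = (a : K)
  adjoin_eq_top : IntermediateField.adjoin ℚ {α} = ⊤

section Orders

variable {K : Type*} [Field K] [NumberField K]

/-- The index `[𝓞 K : 𝓞 K ∩ R]` of additive groups, which is `[𝓞 K : R]` if `R` is contained in
the ring of integers `𝓞 K`, i.e. the integral closure of `ℤ` in `K`. An infinite index has
the value `0`. -/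
noncomputable def ringIndex (R : Subalgebra ℤ K) : ℕ :=
  (Subalgebra.toSubmodule R).toAddSubgroup.relIndex
    (Subalgebra.toSubmodule (integralClosure ℤ K)).toAddSubgroup

/-- `R` is an order of `K`: a subring of finite index in the ring of integers. -/
def IsOrder (R : Subalgebra ℤ K) : Prop :=
  R ≤ integralClosure ℤ K ∧ ringIndex R ≠ 0

/-- `R` is `q`-maximal: it is a subring of the ring of integers whose index is not divisible
by `q`. (Subrings of infinite index are not `q`-maximal, as `q ∣ 0`.) -/
def IsMaximalAt (q : ℕ) (R : Subalgebra ℤ K) : Prop :=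
  R ≤ integralClosure ℤ K ∧ ¬ q ∣ ringIndex R

/-- The product `R · S` of two subrings: all finite sums of products `r * s` with
`r ∈ R` and `s ∈ S`. -/
def ringMul (R S : Subalgebra ℤ K) : Subalgebra ℤ K :=
  (Subalgebra.toSubmodule R * Subalgebra.toSubmodule S).toSubalgebra
    (by
      have hR : (1 : K) ∈ Subalgebra.toSubmodule R := R.one_mem
      have hS : (1 : K) ∈ Subalgebra.toSubmodule S := S.one_mem
      have h := Submodule.mul_mem_mul hR hS
      rwa [one_mul] at h)
    (by
      intro x y hx hy
      have h := Submodule.mul_mem_mul hx hy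
      rwa [mul_mul_mul_comm, Subalgebra.isIdempotentElem_toSubmodule R,
        Subalgebra.isIdempotentElem_toSubmodule S] at h)

end Orders

/-- The element `β' = (α - a) ^ (p - 1) / p` of the field `K`. -/
noncomputable def betaPrime {K : Type*} [Field K] (p : ℕ) (a : ℤ) (α : K) : K :=
  (α - (a : K)) ^ (p - 1) / (p : K)

end RadicalExt

namespace RadicalExt

open Polynomial

/-! Put γ = α - a and θ = γ^(p-1)/p. Expanding (γ + a)^p = a and dividing by p (here p² ∣ a^p - a is
used) gives γθ = -γ(A + bγ + γ²c) - pm, with A = a^(p-1), 2b = (p-1)a^(p-2) and pm = (a^p - a)/p;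
multiplying by γ^(p-2) gives a matching formula for θ². Hence ℤ[γ, θ] = ℤ[γ] + ℤθ is finitely
generated and θ is integral. These facts are packaged in `WieferichRelations`.

The ring ℤ[γ, θ] = ℤ[α, θ] is p-maximal because it is p-saturated (`mem_of_mul_mem`). The tool is
the trace: it maps ℤ[γ] into pℤ, while the traces of θ and of its powers are prime to p. So if px
lies in the ring, the coefficients of px can be shown divisible by p one after another.

For p ≥ 5, θ(θ + A) is bAγ up to γ²ℤ[γ] and multiples of p, with bA prime to p; its powers recover
the powers of γ, so θ alone generates the ring modulo p (`exists_add_mul_of_five_le`). For p = 3 the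
term mγ^(p-2) is itself linear and the coefficient becomes bA - m, which 3 may divide; this happens
for a = 19. -/

/-! ### Divisibility of relative indices by a prime -/

/-- A subgroup of finite relative index that is saturated at a prime `p` has relative index
prime to `p`. -/
theorem not_dvd_relIndex_of_saturated {A : Type*} [AddCommGroup A] {H G : AddSubgroup A} {p : ℕ}
    (hp : p.Prime) (h0 : H.relIndex G ≠ 0) (hsat : ∀ x ∈ G, p • x ∈ H → x ∈ H) :
    ¬ p ∣ H.relIndex G := by
  intro hdvd
  have : (H.addSubgroupOf G).FiniteIndex := ⟨h0⟩
  have : Finite (G ⧸ H.addSubgroupOf G) := AddSubgroup.finite_quotient_of_finiteIndex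
  have : Fact p.Prime := ⟨hp⟩
  obtain ⟨x, hx⟩ := exists_prime_addOrderOf_dvd_card' (G := G ⧸ H.addSubgroupOf G) p hdvd
  induction x using QuotientAddGroup.induction_on with
  | H z =>
    have h1 : p • (z : G ⧸ H.addSubgroupOf G) = 0 := hx ▸ addOrderOf_nsmul_eq_zero _
    have h2 : p • z ∈ H.addSubgroupOf G := (QuotientAddGroup.eq_zero_iff (p • z)).1 h1
    have h3 : z ∈ H.addSubgroupOf G := hsat z z.2 h2
    rw [(QuotientAddGroup.eq_zero_iff z).2 h3, addOrderOf_zero] at hx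
    exact hp.one_lt.ne hx

/-- If `G = H + p G`, then the relative index of `H` in `G`, if finite, is prime to `p`. -/
theorem not_dvd_relIndex_of_add_smul {A : Type*} [AddCommGroup A] {H G : AddSubgroup A} {p : ℕ}
    (hp : p.Prime) (h0 : H.relIndex G ≠ 0)
    (hadd : ∀ x ∈ G, ∃ y ∈ H, ∃ z ∈ G, x = y + p • z) : ¬ p ∣ H.relIndex G := by
  have : (H.addSubgroupOf G).FiniteIndex := ⟨h0⟩
  have : Finite (G ⧸ H.addSubgroupOf G) := AddSubgroup.finite_quotient_of_finiteIndex
  have hsurj : Function.Surjective (fun x : G ⧸ H.addSubgroupOf G => p • x) := by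
    intro x
    induction x using QuotientAddGroup.induction_on with
    | H g =>
      obtain ⟨y, hy, z, hz, h⟩ := hadd g g.2
      refine ⟨((⟨z, hz⟩ : G) : G ⧸ H.addSubgroupOf G), ?_⟩
      change ((p • (⟨z, hz⟩ : G) : G) : G ⧸ H.addSubgroupOf G) = _
      rw [QuotientAddGroup.eq, AddSubgroup.mem_addSubgroupOf]
      have : (((-(p • (⟨z, hz⟩ : G)) + g : G)) : A) = y := by
        push_cast
        rw [h]; abel
      rwa [this]
  have hinj := Finite.injective_iff_surjective.2 hsurj
  refine not_dvd_relIndex_of_saturated hp h0 fun x hx hpx => ?_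
  have : ((⟨x, hx⟩ : G) : G ⧸ H.addSubgroupOf G) = 0 := by
    apply hinj
    change ((p • (⟨x, hx⟩ : G) : G) : G ⧸ H.addSubgroupOf G) = p • 0
    rw [smul_zero, QuotientAddGroup.eq_zero_iff, AddSubgroup.mem_addSubgroupOf]
    exact hpx
  rwa [QuotientAddGroup.eq_zero_iff, AddSubgroup.mem_addSubgroupOf] at this

/-- An element of `G` outside `H` whose `p`-th multiple lies in `H` forces `p` to divide the
relative index, which may be infinite (that is, `0`). -/
theorem dvd_relIndex_of_smul_mem {A : Type*} [AddCommGroup A] {H G : AddSubgroup A} {p : ℕ}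
    (hp : p.Prime) {x : A} (hG : x ∈ G) (hH : x ∉ H) (hpx : p • x ∈ H) : p ∣ H.relIndex G := by
  have : Fact p.Prime := ⟨hp⟩
  have h : addOrderOf ((⟨x, hG⟩ : G) : G ⧸ H.addSubgroupOf G) = p := by
    apply addOrderOf_eq_prime
    · change ((p • (⟨x, hG⟩ : G) : G) : G ⧸ H.addSubgroupOf G) = 0
      rw [QuotientAddGroup.eq_zero_iff, AddSubgroup.mem_addSubgroupOf]
      exact hpx
    · rw [Ne, QuotientAddGroup.eq_zero_iff, AddSubgroup.mem_addSubgroupOf]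
      exact hH
  calc p = _ := h.symm
    _ ∣ _ := addOrderOf_dvd_natCard _

/-! ### The relations between γ and θ -/

/-- The binomial expansion of `(x + a) ^ p` up to the terms that are relevant modulo `p x ^ 3`. -/
theorem exists_add_pow_eq {K : Type*} [CommRing K] {p : ℕ} (hp : p.Prime) (hp2 : p ≠ 2)
    (a : ℤ) (x : K) :
    ∃ b : ℤ, 2 * b = (p - 1) * a ^ (p - 2) ∧ ∃ c ∈ Algebra.adjoin ℤ {x},
      (x + a) ^ p =
        x ^ p + a ^ p + p * x * (((a ^ (p - 1) : ℤ) : K) + b * x + x ^ 2 * c) := by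
  obtain ⟨n, rfl⟩ : ∃ n, p = n + 3 := by
    have := hp.two_le
    exact ⟨p - 3, by omega⟩
  obtain ⟨k, hk⟩ : ∃ k, n + 3 = 2 * k + 1 := (hp.eq_two_or_odd'.resolve_left hp2)
  obtain rfl : n = 2 * k - 2 := by omega
  obtain ⟨j, rfl⟩ : ∃ j, k = j + 1 := ⟨k - 1, by omega⟩
  set n := 2 * (j + 1) - 2 with hn
  have hnj : n = 2 * j := by omega
  refine ⟨(j + 1) * a ^ (n + 1), ?_, ∑ i ∈ Finset.range n,
    x ^ i * (a : K) ^ (n - i) * (((n + 3).choose (i + 3) / (n + 3) : ℕ) : K), ?_, ?_⟩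
  · rw [hnj]; push_cast
    ring
  · refine Subalgebra.sum_mem _ fun i _ => Subalgebra.mul_mem _ (Subalgebra.mul_mem _
      (Subalgebra.pow_mem _ (Algebra.self_mem_adjoin_singleton _ _) _)
      (Subalgebra.pow_mem _ (intCast_mem _ _) _)) (natCast_mem _ _)
  · rw [add_pow, Finset.sum_range_succ, Finset.sum_range_succ', Finset.sum_range_succ',
      Finset.sum_range_succ']
    have h : ∑ i ∈ Finset.range n, x ^ (i + 1 + 1 + 1) * (a : K) ^ (n + 3 - (i + 1 + 1 + 1)) *
        ((n + 3).choose (i + 1 + 1 + 1) : K) =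
        ((n + 3 : ℕ) : K) * x ^ 3 * ∑ i ∈ Finset.range n,
          x ^ i * (a : K) ^ (n - i) * (((n + 3).choose (i + 3) / (n + 3) : ℕ) : K) := by
      rw [Finset.mul_sum]
      refine Finset.sum_congr rfl fun i hi => ?_
      have hi' := Finset.mem_range.1 hi
      have hd : (n + 3) ∣ (n + 3).choose (i + 3) :=
        hp.dvd_choose_self (by omega) (by omega)
      have : ((n + 3).choose (i + 1 + 1 + 1) : K) =
          ((n + 3 : ℕ) : K) * (((n + 3).choose (i + 3) / (n + 3) : ℕ) : K) := by
        rw [← Nat.cast_mul, Nat.mul_div_cancel' hd]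
      rw [this, show n + 3 - (i + 1 + 1 + 1) = n - i by omega]
      ring
    rw [h]
    have hc2 : (((n + 3).choose 2 : ℕ) : K) = ((n + 3 : ℕ) : K) * (j + 1) := by
      have : (n + 3).choose 2 = (n + 3) * (j + 1) := by
        rw [Nat.choose_two_right, hnj, show 2 * j + 3 - 1 = 2 * (j + 1) by omega,
          mul_left_comm, Nat.mul_div_cancel_left _ (by norm_num)]
      rw [this]; push_cast; ring
    simp only [zero_add, Nat.choose_one_right, Nat.choose_zero_right, Nat.choose_self,
      show (1 + 1 : ℕ) = 2 from rfl, hc2, Nat.sub_self, Nat.sub_zero, pow_zero,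
      show n + 3 - 1 = n + 2 by omega, show n + 3 - 2 = n + 1 by omega]
    push_cast
    ring

/-- The relations between `γ = α - a` and `θ = γ ^ (p - 1) / p` at a Wieferich prime `p`. -/
structure WieferichRelations {K : Type*} [Field K] [NumberField K] (p : ℕ) (γ θ c : K)
    (A b m : ℤ) : Prop where
  prime : p.Prime
  three_le : 3 ≤ p
  isIntegral : IsIntegral ℤ γ
  pow_eq : γ ^ (p - 1) = p * θ
  mem_adjoin : c ∈ Algebra.adjoin ℤ {γ}
  mul_eq : γ * θ = -(γ * (A + b * γ + γ ^ 2 * c)) - p * m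
  sq_eq : θ ^ 2 = -(θ * (A + b * γ + γ ^ 2 * c)) - m * γ ^ (p - 2)
  not_dvd_A : ¬ (p : ℤ) ∣ A
  not_dvd_b : ¬ (p : ℤ) ∣ b
  trace_mem : ∀ x ∈ Algebra.adjoin ℤ {γ}, ∃ n : ℤ, Algebra.trace ℚ K x = p * n
  trace_eq : Algebra.trace ℚ K θ = A

theorem exists_int_add_mul_of_mem_adjoin {K : Type*} [CommRing K] {γ x : K}
    (hx : x ∈ Algebra.adjoin ℤ {γ}) :
    ∃ n : ℤ, ∃ y ∈ Algebra.adjoin ℤ {γ}, x = n + γ * y := by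
  have hγ : γ ∈ Algebra.adjoin ℤ {γ} := Algebra.self_mem_adjoin_singleton _ _
  induction hx using Algebra.adjoin_induction with
  | mem x hx =>
    obtain rfl : x = γ := hx
    exact ⟨0, 1, one_mem _, by simp⟩
  | algebraMap r => exact ⟨r, 0, zero_mem _, by simp⟩
  | add x y _ _ hx hy =>
    obtain ⟨n, u, hu, rfl⟩ := hx
    obtain ⟨k, v, hv, rfl⟩ := hy
    exact ⟨n + k, u + v, add_mem hu hv, by push_cast; ring⟩
  | mul x y _ _ hx hy =>
    obtain ⟨n, u, hu, rfl⟩ := hx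
    obtain ⟨k, v, hv, rfl⟩ := hy
    exact ⟨n * k, n * v + k * u + γ * (u * v),
      add_mem (add_mem (mul_mem (intCast_mem _ _) hv) (mul_mem (intCast_mem _ _) hu))
        (mul_mem hγ (mul_mem hu hv)), by push_cast; ring⟩

theorem mem_adjoin_pair_of_mem {K : Type*} [CommRing K] {γ θ x : K}
    (hx : x ∈ Algebra.adjoin ℤ {γ}) : x ∈ Algebra.adjoin ℤ {γ, θ} :=
  Algebra.adjoin_mono (by simp) hx

theorem exists_trace_eq {K : Type*} [Field K] [NumberField K] {x : K} (hx : IsIntegral ℤ x) :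
    ∃ n : ℤ, Algebra.trace ℚ K x = n := by
  obtain ⟨n, hn⟩ := IsIntegrallyClosed.isIntegral_iff.1 (Algebra.isIntegral_trace (L := ℚ) hx)
  exact ⟨n, by simpa using hn.symm⟩

/-! ### Saturation of ℤ[γ, θ] at p, and generation by θ modulo p -/

namespace WieferichRelations

variable {K : Type*} [Field K] [NumberField K] {p : ℕ} {γ θ c : K} {A b m : ℤ}

/-- Since γθ lies in ℤ[γ], a product yθ with y in ℤ[γ] only keeps the constant term of y as
coefficient of θ; the formula for θ² removes higher powers. -/
theorem exists_add_mul_of_mem (h : WieferichRelations p γ θ c A b m) {x : K}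
    (hx : x ∈ Algebra.adjoin ℤ {γ, θ}) :
    ∃ y ∈ Algebra.adjoin ℤ {γ}, ∃ n : ℤ, x = y + n * θ := by
  have hγ : γ ∈ Algebra.adjoin ℤ {γ} := Algebra.self_mem_adjoin_singleton _ _
  have hc := h.mem_adjoin
  have hB : A + b * γ + γ ^ 2 * c ∈ Algebra.adjoin ℤ {γ} :=
    add_mem (add_mem (intCast_mem _ _) (mul_mem (intCast_mem _ _) hγ))
      (mul_mem (pow_mem hγ _) hc)
  have hmul : ∀ y ∈ Algebra.adjoin ℤ {γ}, ∃ z ∈ Algebra.adjoin ℤ {γ}, ∃ n : ℤ,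
      y * θ = z + n * θ := by
    intro y hy
    obtain ⟨n, u, hu, rfl⟩ := exists_int_add_mul_of_mem_adjoin hy
    refine ⟨u * (-(γ * (A + b * γ + γ ^ 2 * c)) - p * m), mul_mem hu (sub_mem (neg_mem
      (mul_mem hγ hB)) (mul_mem (natCast_mem _ _) (intCast_mem _ _))), n, ?_⟩
    rw [← h.mul_eq]; ring
  induction hx using Algebra.adjoin_induction with
  | mem x hx =>
    rcases hx with rfl | rfl
    · exact ⟨x, hγ, 0, by simp⟩
    · exact ⟨0, zero_mem _, 1, by simp⟩
  | algebraMap r => exact ⟨r, intCast_mem _ _, 0, by simp⟩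
  | add x y _ _ hx hy =>
    obtain ⟨u, hu, n, rfl⟩ := hx
    obtain ⟨v, hv, k, rfl⟩ := hy
    exact ⟨u + v, add_mem hu hv, n + k, by push_cast; ring⟩
  | mul x y _ _ hx hy =>
    obtain ⟨u, hu, n, rfl⟩ := hx
    obtain ⟨v, hv, k, rfl⟩ := hy
    obtain ⟨z, hz, l, hzl⟩ := hmul (k * u + n * v - n * k * (A + b * γ + γ ^ 2 * c))
      (sub_mem (add_mem (mul_mem (intCast_mem _ _) hu) (mul_mem (intCast_mem _ _) hv))
        (mul_mem (mul_mem (intCast_mem _ _) (intCast_mem _ _)) hB))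
    refine ⟨u * v - n * k * (m * γ ^ (p - 2)) + z, add_mem (sub_mem (mul_mem hu hv)
      (mul_mem (mul_mem (intCast_mem _ _) (intCast_mem _ _)) (mul_mem (intCast_mem _ _)
      (pow_mem hγ _)))) hz, l, ?_⟩
    linear_combination hzl + (n * k : K) * h.sq_eq

theorem isIntegral_of_mem (h : WieferichRelations p γ θ c A b m) {x : K}
    (hx : x ∈ Algebra.adjoin ℤ {γ, θ}) : IsIntegral ℤ x := by
  refine IsIntegral.of_mem_of_fg (Algebra.adjoin ℤ {γ, θ}) ?_ x hx
  have : Subalgebra.toSubmodule (Algebra.adjoin ℤ {γ, θ}) =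
      Subalgebra.toSubmodule (Algebra.adjoin ℤ {γ}) ⊔ Submodule.span ℤ {θ} := by
    apply le_antisymm
    · intro y hy
      obtain ⟨u, hu, n, rfl⟩ := h.exists_add_mul_of_mem hy
      refine Submodule.add_mem_sup hu (Submodule.mem_span_singleton.2 ⟨n, by simp⟩)
    · refine sup_le (fun y hy => mem_adjoin_pair_of_mem hy) ?_
      rw [Submodule.span_singleton_le_iff_mem]
      exact Algebra.subset_adjoin (by simp)
  rw [this]
  exact h.isIntegral.fg_adjoin_singleton.sup (Submodule.fg_span_singleton _)

theorem isIntegral_theta (h : WieferichRelations p γ θ c A b m) : IsIntegral ℤ θ :=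
  h.isIntegral_of_mem (Algebra.subset_adjoin (by simp))

/-- Modulo γℤ[γ] and p, the relation for θ² reads θ² ≡ -Aθ. The error terms have a trace divisible
by p, so this determines the traces of the powers of θ modulo p. -/
theorem theta_pow (h : WieferichRelations p γ θ c A b m) (n : ℕ) :
    ∃ u ∈ Algebra.adjoin ℤ {γ}, ∃ w ∈ Algebra.adjoin ℤ {γ, θ},
      θ ^ (n + 1) = (-A) ^ n * θ + γ * u + p * w := by
  have hγ : γ ∈ Algebra.adjoin ℤ {γ} := Algebra.self_mem_adjoin_singleton _ _
  have hc := h.mem_adjoin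
  have hB : A + b * γ + γ ^ 2 * c ∈ Algebra.adjoin ℤ {γ} :=
    add_mem (add_mem (intCast_mem _ _) (mul_mem (intCast_mem _ _) hγ))
      (mul_mem (pow_mem hγ _) hc)
  have hC : b + γ * c ∈ Algebra.adjoin ℤ {γ} := add_mem (intCast_mem _ _) (mul_mem hγ hc)
  have hθ : θ ∈ Algebra.adjoin ℤ {γ, θ} := Algebra.subset_adjoin (by simp)
  have hA : (-A : K) ^ n ∈ Algebra.adjoin ℤ {γ} := pow_mem (neg_mem (intCast_mem _ _)) _
  have hm : (m : K) ∈ Algebra.adjoin ℤ {γ} := intCast_mem _ _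
  induction n with
  | zero => exact ⟨0, zero_mem _, 0, zero_mem _, by simp⟩
  | succ n ih =>
    have hA' : (-A : K) ^ n ∈ Algebra.adjoin ℤ {γ} := pow_mem (neg_mem (intCast_mem _ _)) _
    obtain ⟨u, hu, w, hw, hn⟩ := ih hA'
    refine ⟨(-A) ^ n * ((b + γ * c) * (A + b * γ + γ ^ 2 * c) - m * γ ^ (p - 3)) -
        u * (A + b * γ + γ ^ 2 * c), ?_, (-A) ^ n * (b + γ * c) * m - u * m + w * θ, ?_, ?_⟩
    · exact sub_mem (mul_mem hA' (sub_mem (mul_mem hC hB) (mul_mem hm (pow_mem hγ _))))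
        (mul_mem hu hB)
    · exact add_mem (mem_adjoin_pair_of_mem (sub_mem (mul_mem (mul_mem hA' hC) hm) (mul_mem hu hm)))
        (mul_mem hw hθ)
    · have e : γ ^ (p - 2) = γ * γ ^ (p - 3) := by
        rw [← pow_succ']; congr 1; have := h.three_le; omega
      have h1 := h.sq_eq
      rw [e] at h1
      rw [pow_succ, hn, pow_succ]
      linear_combination ((-A : K) ^ n) * h1 + (u - (-A : K) ^ n * (b + γ * c)) * h.mul_eq

theorem exists_trace_theta_pow (h : WieferichRelations p γ θ c A b m) (n : ℕ) :
    ∃ k : ℤ, Algebra.trace ℚ K (θ ^ (n + 1)) = ((-A) ^ n * A + p * k : ℤ) := by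
  obtain ⟨u, hu, w, hw, e⟩ := h.theta_pow n
  obtain ⟨k, hk⟩ := h.trace_mem (γ * u) (mul_mem (Algebra.self_mem_adjoin_singleton _ _) hu)
  obtain ⟨l, hl⟩ := exists_trace_eq (h.isIntegral_of_mem hw)
  refine ⟨k + l, ?_⟩
  have e' : θ ^ (n + 1) = ((-A : ℚ) ^ n) • θ + γ * u + (p : ℚ) • w := by
    rw [e, Algebra.smul_def, Algebra.smul_def]; simp
  rw [e', map_add, map_add, map_smul, map_smul, hk, hl, h.trace_eq]
  push_cast; simp only [smul_eq_mul]; ring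

theorem trace_natCast_mul (x : K) (n : ℕ) :
    Algebra.trace ℚ K (n * x) = n * Algebra.trace ℚ K x := by
  rw [← nsmul_eq_mul, map_nsmul, nsmul_eq_mul]

theorem trace_intCast_mul (x : K) (n : ℤ) :
    Algebra.trace ℚ K (n * x) = n * Algebra.trace ℚ K x := by
  rw [← zsmul_eq_mul, map_zsmul, zsmul_eq_mul]

theorem dvd_of_mul_eq_add_mul (h : WieferichRelations p γ θ c A b m) {x y : K}
    (hx : IsIntegral ℤ x) (hy : y ∈ Algebra.adjoin ℤ {γ}) {n : ℤ} (e : p * x = y + n * θ) :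
    (p : ℤ) ∣ n := by
  obtain ⟨k, hk⟩ := exists_trace_eq hx
  obtain ⟨l, hl⟩ := h.trace_mem y hy
  have h1 := congrArg (Algebra.trace ℚ K) e
  rw [trace_natCast_mul, map_add, trace_intCast_mul, hk, hl, h.trace_eq] at h1
  have h2 : (p : ℤ) * k = p * l + n * A := by exact_mod_cast h1
  have h3 : (p : ℤ) ∣ n * A := ⟨k - l, by linear_combination -h2⟩
  exact ((Nat.prime_iff_prime_int.1 h.prime).dvd_or_dvd h3).resolve_right h.not_dvd_A

theorem dvd_of_mul_eq_mul_pow (h : WieferichRelations p γ θ c A b m) {x : K}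
    (hx : IsIntegral ℤ x) {n : ℤ} (e : p * x = n * γ ^ (p - 2)) : (p : ℤ) ∣ n := by
  have hp := Nat.prime_iff_prime_int.1 h.prime
  have h3 := h.three_le
  have hp0 : (p : K) ≠ 0 := Nat.cast_ne_zero.2 h.prime.ne_zero
  -- Raise `e` to the power p - 1, use γ^((p-2)(p-1)) = (pθ)^(p-2), and cancel p^(p-2).
  have e1 : (p : K) * x ^ (p - 1) = ((n ^ (p - 1) : ℤ) : K) * θ ^ (p - 3 + 1) := by
    have : (p * x) ^ (p - 1) = (n * γ ^ (p - 2)) ^ (p - 1) := by rw [e]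
    rw [mul_pow, mul_pow, ← pow_mul, mul_comm (p - 2), pow_mul, h.pow_eq, mul_pow] at this
    obtain ⟨q, rfl⟩ : ∃ q, p = q + 3 := ⟨p - 3, by omega⟩
    simp only [Nat.add_sub_cancel, show q + 3 - 1 = q + 2 by omega,
      show q + 3 - 2 = q + 1 by omega] at this ⊢
    apply mul_left_cancel₀ (pow_ne_zero (q + 1) hp0)
    push_cast at this ⊢
    linear_combination this
  obtain ⟨k, hk⟩ := exists_trace_eq (hx.pow (p - 1))
  obtain ⟨l, hl⟩ := h.exists_trace_theta_pow (p - 3)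
  have h1 := congrArg (Algebra.trace ℚ K) e1
  rw [trace_natCast_mul, trace_intCast_mul, hk, hl] at h1
  have h2 : (p : ℤ) * k = n ^ (p - 1) * ((-A) ^ (p - 3) * A + p * l) := by exact_mod_cast h1
  have h4 : (p : ℤ) ∣ n ^ (p - 1) * ((-A) ^ (p - 3) * A) :=
    ⟨k - n ^ (p - 1) * l, by linear_combination -h2⟩
  rcases hp.dvd_or_dvd h4 with h5 | h5
  · exact hp.dvd_of_dvd_pow h5
  · rcases hp.dvd_or_dvd h5 with h6 | h6
    · exact absurd ((dvd_neg).1 (hp.dvd_of_dvd_pow h6)) h.not_dvd_A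
    · exact absurd h6 h.not_dvd_A

/-- Descent on p - 1 - k: once the constant term of y is known to be divisible by p, it can be split
off from x and k increases. At k = p - 1 the right side is pθy. -/
theorem mem_of_mul_eq_pow_mul (h : WieferichRelations p γ θ c A b m) (j k : ℕ)
    (hjk : k + j = p - 1) {x y : K} (hx : IsIntegral ℤ x)
    (hy : y ∈ Algebra.adjoin ℤ {γ}) (e : p * x = γ ^ k * y) : x ∈ Algebra.adjoin ℤ {γ, θ} := by
  have hp0 : (p : K) ≠ 0 := Nat.cast_ne_zero.2 h.prime.ne_zero
  have hθ : θ ∈ Algebra.adjoin ℤ {γ, θ} := Algebra.subset_adjoin (by simp)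
  have hγ : γ ∈ Algebra.adjoin ℤ {γ, θ} := Algebra.subset_adjoin (by simp)
  induction j generalizing k x y with
  | zero =>
    obtain rfl : k = p - 1 := by omega
    rw [h.pow_eq, mul_assoc] at e
    rw [mul_left_cancel₀ hp0 e]
    exact mul_mem hθ (mem_adjoin_pair_of_mem hy)
  | succ j ih =>
    obtain ⟨n, z, hz, rfl⟩ := exists_int_add_mul_of_mem_adjoin hy
    -- Multiplying by γ^j lifts the lowest term to γ^(p-2) and turns the rest into γ^(p-1)z = pθz.
    have e1 : p * (γ ^ j * x - θ * z) = n * γ ^ (p - 2) := by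
      have e2 : γ ^ (p - 2) = γ ^ j * γ ^ k := by rw [← pow_add]; congr 1; omega
      have e3 : γ ^ (p - 1) = γ ^ j * γ ^ k * γ := by
        rw [← pow_add, ← pow_succ]; congr 1; omega
      rw [e2]
      have e4 := h.pow_eq
      rw [e3] at e4
      linear_combination γ ^ j * e + z * e4
    obtain ⟨l, rfl⟩ := h.dvd_of_mul_eq_mul_pow (((h.isIntegral.pow j).mul hx).sub
      (h.isIntegral_of_mem (mul_mem hθ (mem_adjoin_pair_of_mem hz)))) e1
    have h1 : x - l * γ ^ k ∈ Algebra.adjoin ℤ {γ, θ} := by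
      refine ih (k + 1) (by omega) (hx.sub (h.isIntegral_of_mem
        (mul_mem (intCast_mem _ _) (pow_mem hγ _)))) hz ?_
      push_cast at e
      rw [pow_succ]
      linear_combination e
    have h2 := add_mem h1 (mul_mem (intCast_mem (Algebra.adjoin ℤ {γ, θ}) l) (pow_mem hγ k))
    rwa [sub_add_cancel] at h2

/-- `ℤ[γ, θ]` is saturated at `p` in the ring of integers. -/
theorem mem_of_mul_mem (h : WieferichRelations p γ θ c A b m) {x : K} (hx : IsIntegral ℤ x)
    (hpx : p * x ∈ Algebra.adjoin ℤ {γ, θ}) : x ∈ Algebra.adjoin ℤ {γ, θ} := by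
  have hθ : θ ∈ Algebra.adjoin ℤ {γ, θ} := Algebra.subset_adjoin (by simp)
  have hγ : γ ∈ Algebra.adjoin ℤ {γ} := Algebra.self_mem_adjoin_singleton _ _
  have hB : A + b * γ + γ ^ 2 * c ∈ Algebra.adjoin ℤ {γ} :=
    add_mem (add_mem (intCast_mem _ _) (mul_mem (intCast_mem _ _) hγ))
      (mul_mem (pow_mem hγ _) h.mem_adjoin)
  obtain ⟨y, hy, n, e⟩ := h.exists_add_mul_of_mem hpx
  obtain ⟨n, rfl⟩ := h.dvd_of_mul_eq_add_mul hx hy e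
  obtain ⟨k, z, hz, rfl⟩ := exists_int_add_mul_of_mem_adjoin hy
  have hx1 : IsIntegral ℤ (x - n * θ) :=
    hx.sub (h.isIntegral_of_mem (mul_mem (intCast_mem _ _) hθ))
  have e1 : p * (x - n * θ) = k + γ * z := by push_cast at e; linear_combination e
  -- Multiplication by θ makes the constant term k the coefficient of θ, where the trace detects it.
  have e2 : p * ((x - n * θ) * θ) = z * (-(γ * (A + b * γ + γ ^ 2 * c)) - p * m) + k * θ := by
    linear_combination θ * e1 + z * h.mul_eq
  obtain ⟨l, rfl⟩ := h.dvd_of_mul_eq_add_mul (hx1.mul h.isIntegral_theta)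
    (mul_mem hz (sub_mem (neg_mem (mul_mem hγ hB)) (mul_mem (natCast_mem _ _)
      (intCast_mem _ _)))) e2
  have h1 : x - n * θ - l ∈ Algebra.adjoin ℤ {γ, θ} := by
    refine h.mem_of_mul_eq_pow_mul (p - 2) 1 (by have := h.three_le; omega)
      (hx1.sub (h.isIntegral_of_mem (intCast_mem _ _))) hz ?_
    push_cast at e1
    linear_combination e1
  have h2 := add_mem h1 (add_mem (mul_mem (intCast_mem _ n) hθ) (intCast_mem _ l))
  convert h2 using 1
  ring

/-- For `p ≥ 5` the ring `ℤ[γ, θ]` is generated by `θ` modulo `p`. -/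
theorem exists_add_mul_of_five_le (h : WieferichRelations p γ θ c A b m) (h5 : 5 ≤ p) {x : K}
    (hx : x ∈ Algebra.adjoin ℤ {γ, θ}) :
    ∃ y ∈ Algebra.adjoin ℤ {θ}, ∃ z ∈ Algebra.adjoin ℤ {γ, θ}, x = y + p * z := by
  have hγ : γ ∈ Algebra.adjoin ℤ {γ} := Algebra.self_mem_adjoin_singleton _ _
  have hθ : θ ∈ Algebra.adjoin ℤ {θ} := Algebra.self_mem_adjoin_singleton _ _
  have hθ' : θ ∈ Algebra.adjoin ℤ {γ, θ} := Algebra.subset_adjoin (by simp)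
  have hp := Nat.prime_iff_prime_int.1 h.prime
  let T : AddSubgroup K :=
    { carrier := {x | ∃ y ∈ Algebra.adjoin ℤ {θ}, ∃ z ∈ Algebra.adjoin ℤ {γ, θ}, x = y + p * z}
      zero_mem' := ⟨0, zero_mem _, 0, zero_mem _, by simp⟩
      add_mem' := by
        rintro _ _ ⟨y, hy, z, hz, rfl⟩ ⟨y', hy', z', hz', rfl⟩
        exact ⟨y + y', add_mem hy hy', z + z', add_mem hz hz', by ring⟩
      neg_mem' := by
        rintro _ ⟨y, hy, z, hz, rfl⟩
        exact ⟨-y, neg_mem hy, -z, neg_mem hz, by ring⟩ }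
  have hTp : ∀ z ∈ Algebra.adjoin ℤ {γ, θ}, p * z ∈ T := fun z hz =>
    ⟨0, zero_mem _, z, hz, by simp⟩
  have hTθ : ∀ y ∈ Algebra.adjoin ℤ {θ}, y ∈ T := fun y hy => ⟨y, hy, 0, zero_mem _, by simp⟩
  have hTz : ∀ (n : ℤ), ∀ z ∈ T, n * z ∈ T := fun n z hz => by
    rw [← zsmul_eq_mul]; exact T.zsmul_mem hz n
  have hbA : ¬ (p : ℤ) ∣ b * A := fun hd =>
    (hp.dvd_or_dvd hd).elim h.not_dvd_b h.not_dvd_A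
  have hC : b + γ * c ∈ Algebra.adjoin ℤ {γ} :=
    add_mem (intCast_mem _ _) (mul_mem hγ h.mem_adjoin)
  have hB : A + b * γ + γ ^ 2 * c ∈ Algebra.adjoin ℤ {γ} :=
    add_mem (add_mem (intCast_mem _ _) (mul_mem (intCast_mem _ _) hγ))
      (mul_mem (pow_mem hγ _) h.mem_adjoin)
  -- θ(θ + A) = -(b + γc)γθ - mγ^(p-2), and γθ is expanded. The last term is absorbed into γ²u only
  -- because p ≥ 4.
  obtain ⟨u, hu, v, hv, hw⟩ : ∃ u ∈ Algebra.adjoin ℤ {γ}, ∃ v ∈ Algebra.adjoin ℤ {γ},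
      θ * (θ + A) = ((b * A : ℤ) : K) * γ + γ ^ 2 * u + p * v := by
    refine ⟨b * (b + γ * c) + c * (A + b * γ + γ ^ 2 * c) - m * γ ^ (p - 4), ?_,
      m * (b + γ * c), mul_mem (intCast_mem _ _) hC, ?_⟩
    · exact sub_mem (add_mem (mul_mem (intCast_mem _ _) hC) (mul_mem h.mem_adjoin hB))
        (mul_mem (intCast_mem _ _) (pow_mem hγ _))
    · have e : γ ^ (p - 2) = γ ^ 2 * γ ^ (p - 4) := by
        rw [← pow_add]; congr 1; omega
      have h1 := h.sq_eq
      rw [e] at h1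
      push_cast
      linear_combination h1 - (b + γ * c) * h.mul_eq
  have hwpow : ∀ k : ℕ, ∃ u ∈ Algebra.adjoin ℤ {γ}, ∃ v ∈ Algebra.adjoin ℤ {γ},
      (θ * (θ + A)) ^ k = (((b * A) ^ k : ℤ) : K) * γ ^ k + γ ^ (k + 1) * u + p * v := by
    intro k
    induction k with
    | zero => exact ⟨0, zero_mem _, 0, zero_mem _, by simp⟩
    | succ k ih =>
      obtain ⟨u', hu', v', hv', e⟩ := ih
      have hI : ∀ n : ℤ, (n : K) ∈ Algebra.adjoin ℤ {γ} := fun n => intCast_mem _ _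
      refine ⟨(((b * A) ^ k : ℤ) : K) * u + ((b * A : ℤ) : K) * u' + γ * (u * u'), ?_,
        ((((b * A) ^ k : ℤ) : K) * γ ^ k + γ ^ (k + 1) * u') * v +
          v' * (((b * A : ℤ) : K) * γ + γ ^ 2 * u + (p : ℤ) * v), ?_, ?_⟩
      · exact add_mem (add_mem (mul_mem (hI _) hu) (mul_mem (hI _) hu'))
          (mul_mem hγ (mul_mem hu hu'))
      · exact add_mem (mul_mem (add_mem (mul_mem (hI _) (pow_mem hγ _))
          (mul_mem (pow_mem hγ _) hu')) hv) (mul_mem hv' (add_mem (add_mem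
            (mul_mem (hI _) hγ) (mul_mem (pow_mem hγ _) hu)) (mul_mem (hI _) hv)))
      · rw [pow_succ, e, hw]; push_cast; ring
  -- Descending induction on k from γ^(p-1) = pθ: the kth power of θ(θ + A) yields (bA)^k γ^k modulo
  -- higher terms, and (bA)^k is invertible modulo p.
  have hdesc : ∀ j k : ℕ, k + j = p - 1 → ∀ y ∈ Algebra.adjoin ℤ {γ}, γ ^ k * y ∈ T := by
    intro j
    induction j with
    | zero =>
      intro k hk y hy
      obtain rfl : k = p - 1 := by omega
      rw [h.pow_eq, mul_assoc]
      exact hTp _ (mul_mem hθ' (mem_adjoin_pair_of_mem hy))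
    | succ j ih =>
      intro k hk y hy
      have hγk : γ ^ k ∈ T := by
        obtain ⟨u', hu', v', hv', e⟩ := hwpow k
        have h1 : (((b * A) ^ k : ℤ) : K) * γ ^ k ∈ T := by
          have h2 := T.sub_mem (T.sub_mem (hTθ _ (pow_mem (mul_mem hθ (add_mem hθ
            (intCast_mem _ A))) k)) (ih (k + 1) (by omega) u' hu'))
            (hTp _ (mem_adjoin_pair_of_mem hv'))
          rw [e] at h2
          convert h2 using 1
          ring
        have h3 : IsCoprime (p : ℤ) ((b * A) ^ k) :=
          ((Prime.coprime_iff_not_dvd hp).2 hbA).pow_right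
        obtain ⟨r, s, hrs⟩ := h3
        have h4 := T.add_mem (hTz r _ (hTp _ (mem_adjoin_pair_of_mem (pow_mem hγ k)))) (hTz s _ h1)
        convert h4 using 1
        have h5 : (r : K) * p + s * (((b * A) ^ k : ℤ) : K) = 1 := by exact_mod_cast hrs
        linear_combination -(γ ^ k) * h5
      obtain ⟨n, z, hz, rfl⟩ := exists_int_add_mul_of_mem_adjoin hy
      have h2 := T.add_mem (hTz n _ hγk) (ih (k + 1) (by omega) z hz)
      convert h2 using 1
      ring
  obtain ⟨y, hy, n, rfl⟩ := h.exists_add_mul_of_mem hx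
  refine T.add_mem ?_ (hTθ _ (mul_mem (intCast_mem _ _) hθ))
  simpa using hdesc (p - 1) 0 (by omega) y hy

end WieferichRelations

/-! ### Adjunction identities and orders generated by a primitive element -/

theorem ringMul_adjoin_singleton {K : Type*} [Field K] (x y : K) :
    ringMul (Algebra.adjoin ℤ {x}) (Algebra.adjoin ℤ {y}) = Algebra.adjoin ℤ {y, x} := by
  apply Subalgebra.toSubmodule_injective
  rw [ringMul, Submodule.toSubalgebra_toSubmodule, ← Algebra.adjoin_union_coe_submodule,
    Set.union_comm]
  rfl

theorem adjoin_sub_intCast {K : Type*} [CommRing K] (x : K) (a : ℤ) (s : Set K) :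
    Algebra.adjoin ℤ (insert (x - a) s) = Algebra.adjoin ℤ (insert x s) := by
  apply le_antisymm <;> refine Algebra.adjoin_le (Set.insert_subset ?_ ?_)
  · exact sub_mem (Algebra.subset_adjoin (by simp)) (intCast_mem _ _)
  · exact fun y hy => Algebra.subset_adjoin (by simp [hy])
  · have : x - a + a ∈ Algebra.adjoin ℤ (insert (x - a) s) :=
      add_mem (Algebra.subset_adjoin (by simp)) (intCast_mem _ _)
    rwa [sub_add_cancel] at this
  · exact fun y hy => Algebra.subset_adjoin (by simp [hy])

section

variable {K : Type*} [Field K] [NumberField K]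

/-- If `x` generates `K` over `ℚ`, then `K` is torsion modulo `ℤ[x]`. -/
theorem exists_mul_mem_adjoin {x : K} (hx : IntermediateField.adjoin ℚ {x} = ⊤) (y : K) :
    ∃ n : ℕ, n ≠ 0 ∧ n * y ∈ Algebra.adjoin ℤ {x} := by
  have hy : y ∈ Algebra.adjoin ℚ {x} := by
    rw [← IntermediateField.adjoin_simple_toSubalgebra_of_isAlgebraic
      (Algebra.IsAlgebraic.isAlgebraic x), hx]
    exact IntermediateField.mem_top
  induction hy using Algebra.adjoin_induction with
  | mem y hy => exact ⟨1, one_ne_zero, by simpa using Algebra.subset_adjoin hy⟩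
  | algebraMap r =>
    refine ⟨r.den, r.den_ne_zero, ?_⟩
    have : (r.den : K) * algebraMap ℚ K r = (r.num : K) := by
      have h : ((r.den : ℚ) * r : ℚ) = r.num := Rat.den_mul_eq_num r
      rw [← map_natCast (algebraMap ℚ K), ← map_mul, h, map_intCast]
    rw [this]
    exact intCast_mem _ _
  | add y z _ _ hy hz =>
    obtain ⟨n, hn, hny⟩ := hy
    obtain ⟨k, hk, hkz⟩ := hz
    refine ⟨n * k, mul_ne_zero hn hk, ?_⟩
    have := add_mem (mul_mem (natCast_mem _ k) hny) (mul_mem (natCast_mem _ n) hkz)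
    convert this using 1
    push_cast; ring
  | mul y z _ _ hy hz =>
    obtain ⟨n, hn, hny⟩ := hy
    obtain ⟨k, hk, hkz⟩ := hz
    refine ⟨n * k, mul_ne_zero hn hk, ?_⟩
    have := mul_mem hny hkz
    convert this using 1
    push_cast; ring

/-- The quotient of the ring of integers by ℤ[x] is finitely generated and torsion, hence finite. -/
theorem isOrder_adjoin {x : K} (hx : IntermediateField.adjoin ℚ {x} = ⊤) (hi : IsIntegral ℤ x) :
    IsOrder (Algebra.adjoin ℤ {x}) := by
  refine ⟨Algebra.adjoin_le (Set.singleton_subset_iff.2 hi), ?_⟩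
  set R := (Subalgebra.toSubmodule (Algebra.adjoin ℤ {x})).toAddSubgroup
  set G := (Subalgebra.toSubmodule (integralClosure ℤ K)).toAddSubgroup
  change (R.addSubgroupOf G).index ≠ 0
  have hfin : Module.Finite ℤ (integralClosure ℤ K) :=
    IsIntegralClosure.finite ℤ ℚ K (integralClosure ℤ K)
  have hfg : AddGroup.FG G := Module.Finite.iff_addGroup_fg.1 hfin
  have htors : IsAddTorsion (G ⧸ R.addSubgroupOf G) := by
    intro y
    induction y using QuotientAddGroup.induction_on with
    | H z =>
      obtain ⟨n, hn, hnz⟩ := exists_mul_mem_adjoin hx (z : K)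
      rw [isOfFinAddOrder_iff_nsmul_eq_zero]
      refine ⟨n, Nat.pos_of_ne_zero hn, ?_⟩
      change ((n • z : G) : G ⧸ R.addSubgroupOf G) = 0
      rw [QuotientAddGroup.eq_zero_iff, AddSubgroup.mem_addSubgroupOf]
      change n • (z : K) ∈ Algebra.adjoin ℤ {x}
      rwa [nsmul_eq_mul]
  have : Finite (G ⧸ R.addSubgroupOf G) := AddCommGroup.finite_of_fg_isAddTorsion _ htors
  exact AddSubgroup.index_ne_zero_of_finite

end

/-! ### Traces and primitive elements in ℚ(α) -/

namespace IsRadicalExtension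

variable {K : Type*} [Field K] [NumberField K] {p : ℕ} {a : ℤ} {α : K}

theorem minpoly_eq (h : IsRadicalExtension p a K α) : minpoly ℚ α = X ^ p - C (a : ℚ) := by
  have hm : (X ^ p - C a : ℤ[X]).Monic :=
    monic_X_pow_sub_C _ (by have := h.two_le; omega)
  have hirr := (hm.irreducible_iff_irreducible_map_fraction_map (K := ℚ)).1 h.irreducible
  have e : (X ^ p - C a : ℤ[X]).map (algebraMap ℤ ℚ) = X ^ p - C (a : ℚ) := by simp
  rw [e] at hirr
  refine (minpoly.eq_of_irreducible_of_monic hirr ?_ ?_).symm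
  · simp [h.pow_eq]
  · rw [← e]; exact hm.map _

theorem finrank_eq (h : IsRadicalExtension p a K α) : Module.finrank ℚ K = p := by
  have h1 := IntermediateField.adjoin.finrank
    (Algebra.IsIntegral.isIntegral (R := ℚ) α)
  rw [h.adjoin_eq_top, IntermediateField.finrank_top', h.minpoly_eq,
    natDegree_X_pow_sub_C] at h1
  exact h1

theorem aeval_ne_zero (h : IsRadicalExtension p a K α) {f : ℚ[X]} (hf : f ≠ 0)
    (hd : f.natDegree < p) : aeval α f ≠ 0 := by
  intro h0
  have := natDegree_le_of_dvd (minpoly.dvd ℚ α h0) hf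
  rw [h.minpoly_eq, natDegree_X_pow_sub_C] at this
  omega

theorem isIntegral (h : IsRadicalExtension p a K α) : IsIntegral ℤ α := by
  refine IsIntegral.of_pow (n := p) (by have := h.two_le; omega) ?_
  rw [h.pow_eq]
  exact isIntegral_algebraMap (R := ℤ) (x := a)

/-- In prime degree, every nonrational element is a primitive element. -/
theorem adjoin_eq_top_of_notMem (h : IsRadicalExtension p a K α) (hp : p.Prime) {x : K}
    (hx : ∀ r : ℚ, x ≠ algebraMap ℚ K r) : IntermediateField.adjoin ℚ {x} = ⊤ := by
  have := IntermediateField.isSimpleOrder_of_finrank_prime ℚ K (h.finrank_eq.symm ▸ hp)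
  refine (eq_bot_or_eq_top _).resolve_left fun hb => ?_
  rw [IntermediateField.adjoin_simple_eq_bot_iff, IntermediateField.mem_bot] at hb
  obtain ⟨r, hr⟩ := hb
  exact hx r hr.symm

/-- The power α^j is again primitive, with minimal polynomial X^p - a^j, which has no term of degree
p - 1. -/
theorem trace_pow_eq_zero (h : IsRadicalExtension p a K α) (hp : p.Prime) {j : ℕ} (h0 : 0 < j)
    (hj : j < p) : Algebra.trace ℚ K (α ^ j) = 0 := by
  have hprim : IntermediateField.adjoin ℚ {α ^ j} = ⊤ := by
    refine h.adjoin_eq_top_of_notMem hp fun r hr => ?_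
    refine h.aeval_ne_zero (f := X ^ j - C r) (X_pow_sub_C_ne_zero h0 r)
      (by rwa [natDegree_X_pow_sub_C]) ?_
    simp [hr]
  have hd := IntermediateField.adjoin.finrank (Algebra.IsIntegral.isIntegral (R := ℚ) (α ^ j))
  rw [hprim, IntermediateField.finrank_top', h.finrank_eq] at hd
  have hmp : minpoly ℚ (α ^ j) = X ^ p - C ((a : ℚ) ^ j) := by
    refine (minpoly.unique' ℚ (α ^ j) (monic_X_pow_sub_C _ hp.ne_zero) ?_ ?_).symm
    · simp only [map_sub, map_pow, aeval_X, aeval_C]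
      rw [← pow_mul, mul_comm j, pow_mul, h.pow_eq]; simp
    · intro q hq
      by_contra! hcon
      have h1 := natDegree_le_of_dvd (minpoly.dvd ℚ (α ^ j) hcon.2) hcon.1
      rw [← hd] at h1
      have h2 := natDegree_lt_natDegree hcon.1 hq
      rw [natDegree_X_pow_sub_C] at h2
      omega
  rw [trace_eq_finrank_mul_minpoly_nextCoeff, hmp,
    nextCoeff_of_natDegree_pos (by rw [natDegree_X_pow_sub_C]; exact hp.pos),
    natDegree_X_pow_sub_C]
  have := hp.two_le
  rw [coeff_sub, coeff_X_pow, if_neg (by omega), coeff_C, if_neg (by omega)]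
  simp

theorem trace_intCast (h : IsRadicalExtension p a K α) (n : ℤ) :
    Algebra.trace ℚ K n = p * n := by
  have := Algebra.trace_algebraMap (S := K) (n : ℚ)
  rw [h.finrank_eq] at this
  simpa using this

theorem exists_trace_eq_mul (h : IsRadicalExtension p a K α) (hp : p.Prime) {x : K}
    (hx : x ∈ Algebra.adjoin ℤ {α}) : ∃ n : ℤ, Algebra.trace ℚ K x = p * n := by
  rw [Algebra.adjoin_singleton_eq_range_aeval] at hx
  obtain ⟨f, rfl⟩ := hx
  induction f using Polynomial.induction_on' with
  | add f g hf hg =>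
    obtain ⟨n, hn⟩ := hf
    obtain ⟨k, hk⟩ := hg
    exact ⟨n + k, by simp only [map_add] at hn hk ⊢; rw [hn, hk]; push_cast; ring⟩
  | monomial i c =>
    have e : aeval α (monomial i c) = ((c * a ^ (i / p) : ℤ) : K) * α ^ (i % p) := by
      rw [aeval_monomial]
      conv_lhs => rw [← Nat.div_add_mod i p, pow_add, pow_mul, h.pow_eq]
      push_cast
      simp [mul_assoc]
    change ∃ n : ℤ, Algebra.trace ℚ K (aeval α (monomial i c)) = p * n
    rw [e, WieferichRelations.trace_intCast_mul]
    rcases Nat.eq_zero_or_pos (i % p) with h0 | h0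
    · refine ⟨c * a ^ (i / p), ?_⟩
      have := h.trace_intCast 1
      rw [h0, pow_zero, ← Int.cast_one, this]
      push_cast; ring
    · exact ⟨0, by rw [h.trace_pow_eq_zero hp h0 (Nat.mod_lt _ hp.pos)]; simp⟩

theorem mul_betaPrime (hp : p.Prime) : (p : K) * betaPrime p a α = (α - a) ^ (p - 1) := by
  rw [betaPrime, mul_div_cancel₀ _ (Nat.cast_ne_zero.2 hp.ne_zero)]

theorem trace_betaPrime (h : IsRadicalExtension p a K α) (hp : p.Prime) (hp2 : p ≠ 2) :
    Algebra.trace ℚ K (betaPrime p a α) = (a ^ (p - 1) : ℤ) := by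
  have hp0 : (p : ℚ) ≠ 0 := Nat.cast_ne_zero.2 hp.ne_zero
  apply mul_left_cancel₀ hp0
  -- In (α - a)^(p-1) only the constant term has nonzero trace, namely p·a^(p-1), as p - 1 is even.
  rw [← WieferichRelations.trace_natCast_mul, mul_betaPrime hp, sub_eq_add_neg, add_pow, map_sum,
    Finset.sum_eq_single 0]
  · have he : Even (p - 1) := hp.even_sub_one hp2
    have := h.trace_intCast (a ^ (p - 1))
    simpa [he.neg_pow] using this
  · intro j hj hj0
    have hj' := Finset.mem_range.1 hj
    have e : α ^ j * (-(a : K)) ^ (p - 1 - j) * ((p - 1).choose j : K) =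
        (((-a) ^ (p - 1 - j) * ((p - 1).choose j) : ℤ) : K) * α ^ j := by push_cast; ring
    rw [e, WieferichRelations.trace_intCast_mul,
      h.trace_pow_eq_zero hp (Nat.pos_of_ne_zero hj0) (by omega), mul_zero]
  · simp

theorem adjoin_betaPrime_eq_top (h : IsRadicalExtension p a K α) (hp : p.Prime) :
    IntermediateField.adjoin ℚ {betaPrime p a α} = ⊤ := by
  refine h.adjoin_eq_top_of_notMem hp fun r hr => ?_
  have h2 := hp.two_le
  have hd : ((X - C (a : ℚ)) ^ (p - 1)).natDegree = p - 1 := by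
    rw [natDegree_pow, natDegree_X_sub_C, mul_one]
  have hdeg : ((X - C (a : ℚ)) ^ (p - 1) - C (p * r)).natDegree = p - 1 := by
    rw [natDegree_sub_C, hd]
  -- If θ were the rational r, α would be a root of this polynomial of degree p - 1 < p.
  refine h.aeval_ne_zero (f := (X - C (a : ℚ)) ^ (p - 1) - C (p * r)) ?_ (by omega) ?_
  · intro h0
    rw [h0, natDegree_zero] at hdeg
    omega
  · have := mul_betaPrime (a := a) (α := α) hp
    rw [hr] at this
    simp [← this]

theorem exists_wieferichRelations (h : IsRadicalExtension p a K α) (hp2 : p ≠ 2)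
    (hw : IsWieferichPrime p a) :
    ∃ (c : K) (A b m : ℤ), WieferichRelations p (α - a) (betaPrime p a α) c A b m := by
  obtain ⟨hp, -, -, -, k, hk⟩ := hw
  have h3 : 3 ≤ p := by have := hp.two_le; omega
  have hpZ := Nat.prime_iff_prime_int.1 hp
  have hp0 : (p : K) ≠ 0 := Nat.cast_ne_zero.2 hp.ne_zero
  obtain ⟨b, hb, c, hc, e⟩ := exists_add_pow_eq hp hp2 a (α - a)
  have hβ := mul_betaPrime (a := a) (α := α) hp
  set γ := α - a
  set θ := betaPrime p a α
  have hA : ¬ (p : ℤ) ∣ a ^ (p - 1) := fun hd => by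
    have h1 : (p : ℤ) ∣ 1 := by
      have h2 : (p : ℤ) ∣ a ^ (p - 1) - 1 := hk ▸ (Dvd.intro _ (by ring : (p : ℤ) * (p * k) = _))
      simpa using dvd_sub hd h2
    exact hpZ.not_isUnit (isUnit_of_dvd_one h1)
  have ha : a ^ p - a = p ^ 2 * (a * k) := by
    have : a ^ p = a * a ^ (p - 1) := by rw [← pow_succ']; congr 1; omega
    rw [this]; linear_combination a * hk
  have haK : (a : K) ^ p - a = p ^ 2 * ((a * k : ℤ) : K) := by
    exact_mod_cast congrArg (Int.cast (R := K)) ha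
  have hαγ : γ + a = α := sub_add_cancel _ _
  rw [hαγ, h.pow_eq] at e
  have hγp : γ ^ p = γ * (p * θ) := by
    rw [hβ, ← pow_succ']; congr 1; omega
  have hmul : γ * θ = -(γ * (((a ^ (p - 1) : ℤ) : K) + b * γ + γ ^ 2 * c)) -
      p * ((a * k : ℤ) : K) := by
    apply mul_left_cancel₀ hp0
    linear_combination -e - haK - hγp
  refine ⟨c, a ^ (p - 1), b, a * k, hp, h3, ?_, hβ.symm, hc, hmul, ?_, hA, ?_, ?_,
    h.trace_betaPrime hp hp2⟩
  · exact h.isIntegral.sub (isIntegral_algebraMap (R := ℤ) (x := a))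
  · apply mul_left_cancel₀ hp0
    have e2 : γ ^ (p - 1) = γ * γ ^ (p - 2) := by rw [← pow_succ']; congr 1; omega
    rw [e2] at hβ
    linear_combination (θ + (((a ^ (p - 1) : ℤ) : K) + b * γ + γ ^ 2 * c)) * hβ +
      γ ^ (p - 2) * hmul
  · intro hd
    have h1 : (p : ℤ) ∣ (p - 1) * a ^ (p - 2) := hb ▸ hd.mul_left 2
    rcases hpZ.dvd_or_dvd h1 with h2 | h2
    · have : (p : ℤ) ∣ 1 := by simpa using dvd_sub (dvd_refl (p : ℤ)) h2
      exact hpZ.not_isUnit (isUnit_of_dvd_one this)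
    · exact hA ((hpZ.dvd_of_dvd_pow h2).trans (dvd_pow_self a (by omega)))
  · intro x hx
    refine h.exists_trace_eq_mul hp ?_
    have := adjoin_sub_intCast α a ∅
    simp only [insert_empty_eq] at this
    rwa [← this]

end IsRadicalExtension

/-! ### Maximality at p -/

theorem WieferichRelations.isMaximalAt_adjoin_pair {K : Type*} [Field K] [NumberField K] {p : ℕ}
    {γ θ c : K} {A b m : ℤ} (h : WieferichRelations p γ θ c A b m)
    (ho : IsOrder (Algebra.adjoin ℤ {θ})) : IsMaximalAt p (Algebra.adjoin ℤ {γ, θ}) := by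
  refine ⟨fun x hx => h.isIntegral_of_mem hx, ?_⟩
  refine not_dvd_relIndex_of_saturated h.prime ?_ fun x hx hpx => ?_
  · intro h0
    refine ho.2 ?_
    have hle : Algebra.adjoin ℤ {θ} ≤ Algebra.adjoin ℤ {γ, θ} := Algebra.adjoin_mono (by simp)
    have := AddSubgroup.relIndex_dvd_of_le_left
      (Subalgebra.toSubmodule (integralClosure ℤ K)).toAddSubgroup
      (show (Subalgebra.toSubmodule (Algebra.adjoin ℤ {θ})).toAddSubgroup ≤
        (Subalgebra.toSubmodule (Algebra.adjoin ℤ {γ, θ})).toAddSubgroup from hle)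
    rw [h0] at this
    exact zero_dvd_iff.1 this
  · rw [nsmul_eq_mul] at hpx
    exact h.mem_of_mul_mem hx hpx

theorem WieferichRelations.isMaximalAt_adjoin_singleton {K : Type*} [Field K] [NumberField K]
    {p : ℕ} {γ θ c : K} {A b m : ℤ} (h : WieferichRelations p γ θ c A b m)
    (ho : IsOrder (Algebra.adjoin ℤ {θ})) (h5 : 5 ≤ p) :
    IsMaximalAt p (Algebra.adjoin ℤ {θ}) := by
  have hmax := h.isMaximalAt_adjoin_pair ho
  refine ⟨ho.1, fun hd => ?_⟩
  have hle : Algebra.adjoin ℤ {θ} ≤ Algebra.adjoin ℤ {γ, θ} := Algebra.adjoin_mono (by simp)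
  have hmul := AddSubgroup.relIndex_mul_relIndex
    (Subalgebra.toSubmodule (Algebra.adjoin ℤ {θ})).toAddSubgroup
    (Subalgebra.toSubmodule (Algebra.adjoin ℤ {γ, θ})).toAddSubgroup
    (Subalgebra.toSubmodule (integralClosure ℤ K)).toAddSubgroup hle hmax.1
  have h0 := ho.2
  unfold ringIndex at hd h0
  rw [← hmul] at hd h0
  rcases h.prime.dvd_mul.1 hd with h1 | h1
  · refine not_dvd_relIndex_of_add_smul h.prime (left_ne_zero_of_mul h0) (fun x hx => ?_) h1
    obtain ⟨y, hy, z, hz, e⟩ := h.exists_add_mul_of_five_le h5 hx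
    exact ⟨y, hy, z, hz, by rw [e, nsmul_eq_mul]⟩
  · exact hmax.2 h1

/-! ### The counterexample for a = 19 -/

theorem irreducible_X_pow_three_sub_C_nineteen : Irreducible (X ^ 3 - C 19 : ℤ[X]) := by
  have hm : (X ^ 3 - C 19 : ℤ[X]).Monic := monic_X_pow_sub_C _ (by norm_num)
  have hd : (X ^ 3 - C 19 : ℤ[X]).natDegree = 3 := natDegree_X_pow_sub_C
  have hP : (Ideal.span {(19 : ℤ)}).IsPrime :=
    (Ideal.span_singleton_prime (by norm_num)).2 (Int.prime_iff_natAbs_prime.2 (by norm_num))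
  have hE : (X ^ 3 - C 19 : ℤ[X]).IsEisensteinAt (Ideal.span {19}) := by
    refine ⟨?_, fun {n} hn => ?_, ?_⟩
    · rw [hm.leadingCoeff, Ideal.mem_span_singleton]
      norm_num
    · rw [hd] at hn
      rw [Ideal.mem_span_singleton]
      interval_cases n <;> simp [coeff_X_pow]
    · rw [Ideal.span_singleton_pow, Ideal.mem_span_singleton]
      simp [coeff_X_pow]
  exact hE.irreducible hP hm.isPrimitive (by rw [hd]; norm_num)

theorem IsRadicalExtension.not_isMaximalAt_three {K : Type*} [Field K] [NumberField K] {α : K}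
    (h : IsRadicalExtension 3 19 K α) :
    ¬ IsMaximalAt 3 (Algebra.adjoin ℤ {betaPrime 3 19 α}) := by
  rintro ⟨-, hmax⟩
  have hβ : (3 : K) * betaPrime 3 19 α = (α - 19) ^ 2 := by
    simpa using IsRadicalExtension.mul_betaPrime (a := 19) (α := α) Nat.prime_three
  have hα : α ^ 3 = 19 := by simpa using h.pow_eq
  set γ := α - 19 with hγ
  set θ := betaPrime 3 19 α
  have e1 : γ * θ = -57 * θ - 361 * γ - 2280 := by
    have h3 : (3 : K) ≠ 0 := by norm_num
    apply mul_left_cancel₀ h3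
    have : α = γ + 19 := by rw [hγ]; ring
    rw [this] at hα
    linear_combination (γ + 57) * hβ + hα
  have e2 : θ ^ 2 = 722 * θ + 6099 * γ + 43320 := by
    have h3 : (3 : K) ≠ 0 := by norm_num
    apply mul_left_cancel₀ h3
    linear_combination (θ + 361) * hβ + (γ - 57) * e1
  -- ℤ + ℤθ + 3ℤγ is closed under multiplication because 6099 = 3·2033 in `e2`; it contains ℤ[θ] and
  -- 3γ but not γ.
  let N : AddSubgroup K :=
    { carrier := {t | ∃ x y z : ℤ, t = x + y * θ + 3 * z * γ}
      zero_mem' := ⟨0, 0, 0, by simp⟩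
      add_mem' := by
        rintro _ _ ⟨x, y, z, rfl⟩ ⟨x', y', z', rfl⟩
        exact ⟨x + x', y + y', z + z', by push_cast; ring⟩
      neg_mem' := by
        rintro _ ⟨x, y, z, rfl⟩
        exact ⟨-x, -y, -z, by push_cast; ring⟩ }
  have hle : (Subalgebra.toSubmodule (Algebra.adjoin ℤ {θ})).toAddSubgroup ≤ N := by
    intro t ht
    change t ∈ Algebra.adjoin ℤ {θ} at ht
    induction ht using Algebra.adjoin_induction with
    | mem t ht =>
      obtain rfl : t = θ := ht
      exact ⟨0, 1, 0, by simp⟩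
    | algebraMap r => exact ⟨r, 0, 0, by simp⟩
    | add t u _ _ ht hu => exact N.add_mem ht hu
    | mul t u _ _ ht hu =>
      obtain ⟨x, y, z, rfl⟩ := ht
      obtain ⟨x', y', z', rfl⟩ := hu
      refine ⟨x * x' + 43320 * y * y' - 6840 * (y * z' + y' * z),
        x * y' + x' * y + 722 * y * y' - 171 * (y * z' + y' * z) + 27 * z * z',
        x * z' + x' * z + 2033 * y * y' - 361 * (y * z' + y' * z), ?_⟩
      push_cast
      linear_combination y * y' * e2 + 3 * (y * z' + y' * z) * e1 - 9 * z * z' * hβ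
  refine hmax ((dvd_relIndex_of_smul_mem (x := γ) Nat.prime_three ?_ ?_ ?_).trans
    (AddSubgroup.relIndex_dvd_of_le_left _ hle))
  · exact h.isIntegral.sub (by simpa using isIntegral_algebraMap (R := ℤ) (A := K) (x := 19))
  · rintro ⟨x, y, z, e⟩
    -- With θ = γ²/3, membership of γ in `N` makes α a root of f. Degree at most 2 forces f = 0, and
    -- the values at 19 ± 1 isolate the linear coefficient 3z - 1.
    set f : ℚ[X] := C (y / 3 : ℚ) * (X - C 19) ^ 2 + C (3 * z - 1 : ℚ) * (X - C 19) + C (x : ℚ)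
      with hf
    have hf0 : f = 0 := by
      by_contra hf0
      refine h.aeval_ne_zero hf0 (lt_of_le_of_lt ?_ (by norm_num : 2 < 3)) ?_
      · rw [hf]; compute_degree
      · simp only [hf, map_add, map_mul, map_sub, map_pow, aeval_X, aeval_C]
        simp only [map_div₀, map_intCast, map_ofNat, map_one]
        rw [← hγ]
        have h3 : (3 : K) ≠ 0 := by norm_num
        field_simp
        linear_combination -3 * e - y * hβ
    have ev : ∀ t : ℚ, (y / 3 : ℚ) * (t - 19) ^ 2 + (3 * z - 1) * (t - 19) + x = 0 := fun t => by
      simpa [hf] using congrArg (eval t) hf0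
    have hz : (3 : ℚ) * z - 1 = 0 := by linarith [ev 20, ev 18]
    have hz' : 3 * z = 1 := by
      have : (3 : ℚ) * z = 1 := by linarith
      exact_mod_cast this
    omega
  · exact ⟨0, 0, 1, by simp⟩

theorem exists_isRadicalExtension {n : ℕ} {a : ℤ} (hn : 2 ≤ n)
    (hirr : Irreducible (X ^ n - C a : ℤ[X])) :
    ∃ (K : Type) (_ : Field K) (_ : NumberField K) (α : K), IsRadicalExtension n a K α := by
  have hm : (X ^ n - C a : ℤ[X]).Monic := monic_X_pow_sub_C _ (by omega)
  have hirr' := (hm.irreducible_iff_irreducible_map_fraction_map (K := ℚ)).1 hirr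
  have e : (X ^ n - C a : ℤ[X]).map (algebraMap ℤ ℚ) = X ^ n - C (a : ℚ) := by simp
  rw [e] at hirr'
  have : Fact (Irreducible (X ^ n - C (a : ℚ))) := ⟨hirr'⟩
  have hfin : FiniteDimensional ℚ (AdjoinRoot (X ^ n - C (a : ℚ))) :=
    (AdjoinRoot.powerBasis hirr'.ne_zero).finite
  refine ⟨AdjoinRoot (X ^ n - C (a : ℚ)), inferInstance, ⟨⟩, AdjoinRoot.root _, hn, hirr, ?_, ?_⟩
  · have := AdjoinRoot.eval₂_root (X ^ n - C (a : ℚ))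
    rw [eval₂_sub, eval₂_X_pow, eval₂_C] at this
    exact (sub_eq_zero.1 this).trans (map_intCast (AdjoinRoot.of (X ^ n - C (a : ℚ))) a)
  · rw [← IntermediateField.toSubalgebra_inj,
      IntermediateField.adjoin_simple_toSubalgebra_of_isAlgebraic
        (Algebra.IsAlgebraic.isAlgebraic _)]
    exact AdjoinRoot.adjoinRoot_eq_top

end RadicalExt

theorem proposition3p1 :
    (∀ (p : ℕ) (a : ℤ) (K : Type*) [Field K] [NumberField K] (α : K),
      p ≠ 2 → RadicalExt.IsRadicalExtension p a K α → RadicalExt.IsWieferichPrime p a →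
        RadicalExt.IsOrder (Algebra.adjoin ℤ {RadicalExt.betaPrime p a α}) ∧
        (5 ≤ p →
          RadicalExt.IsMaximalAt p (Algebra.adjoin ℤ {RadicalExt.betaPrime p a α})) ∧
        (p = 3 →
          RadicalExt.IsMaximalAt 3
            (RadicalExt.ringMul (Algebra.adjoin ℤ {RadicalExt.betaPrime p a α})
              (Algebra.adjoin ℤ {α})))) ∧
    (RadicalExt.IsWieferichPrime 3 19 ∧
      ∃ (K : Type) (_ : Field K) (_ : NumberField K) (α : K),
        RadicalExt.IsRadicalExtension 3 19 K α ∧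
        ¬ RadicalExt.IsMaximalAt 3 (Algebra.adjoin ℤ {RadicalExt.betaPrime 3 19 α})) := by
  refine ⟨fun p a K _ _ α hp2 h hw => ?_, ⟨by norm_num, by norm_num, by norm_num, by norm_num,
    by norm_num⟩, ?_⟩
  · obtain ⟨c, A, b, m, hr⟩ := h.exists_wieferichRelations hp2 hw
    have ho := RadicalExt.isOrder_adjoin (h.adjoin_betaPrime_eq_top hw.1) hr.isIntegral_theta
    refine ⟨ho, hr.isMaximalAt_adjoin_singleton ho, fun h3 => ?_⟩
    rw [RadicalExt.ringMul_adjoin_singleton, ← RadicalExt.adjoin_sub_intCast α a]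
    have := hr.isMaximalAt_adjoin_pair ho
    rwa [h3] at this ⊢
  · obtain ⟨K, _, _, α, h⟩ := RadicalExt.exists_isRadicalExtension (by norm_num)
      RadicalExt.irreducible_X_pow_three_sub_C_nineteen
    exact ⟨K, inferInstance, inferInstance, α, h, h.not_isMaximalAt_three⟩
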